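/- For an integer $n \ge 0$ let $R(n)$ denote the number of partitions of $n$ into distinct Fibonacci numbers, that is, the number of finite subsets of $\{1,2,3,5,8,\dots\}$ whose elements sum to $n$ (so $R(0)=1$), and let $\varphi=\frac{1+\sqrt5}{2}$. Then the set of $n\ge 0$ with $R(n)=R(n+1)$ has asymptotic density $$\lim_{N\to\infty}\frac{\#\{0\le n<N : R(n)=R(n+1)\}}{N}=\frac{1}{\varphi^4}+\frac{1}{\varphi^5}=\frac{1}{\varphi^3}\approx 0.236 .$$ -/

import Mathlib

/-- `S` is a partition of `n` into distinct Fibonacci numbers: `S` is a finite set of numbers from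
`{F_k : k ≥ 2} = {1, 2, 3, 5, 8, …}` (each of them occurs once as a value) with sum `n`. -/
def IsFibPartition (n : ℕ) (S : Finset ℕ) : Prop :=
  (∀ x ∈ S, ∃ k : ℕ, 2 ≤ k ∧ x = Nat.fib k) ∧ ∑ x ∈ S, x = n

/-- The set of such partitions is finite, so its `Set.ncard` is its true number of elements. -/
theorem finite_setOf_isFibPartition (n : ℕ) : {S : Finset ℕ | IsFibPartition n S}.Finite := by
  refine (Finset.finite_toSet (Finset.range (n + 1)).powerset).subset ?_
  intro S hS
  rw [Finset.mem_coe, Finset.mem_powerset]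
  intro x hx
  rw [Finset.mem_range, Nat.lt_succ_iff, ← hS.2]
  exact Finset.single_le_sum (f := fun y : ℕ => y) (fun _ _ => Nat.zero_le _) hx

/-- The Fibonacci partition function `R(n)`: the number of partitions of `n` into distinct
Fibonacci numbers. -/
noncomputable def fibPartitionCount (n : ℕ) : ℕ :=
  {S : Finset ℕ | IsFibPartition n S}.ncard

/-- The set `A` of natural numbers has asymptotic density `d`: the limit of
`#{n < N : n ∈ A} / N` as `N → ∞` exists and equals `d`. -/
def HasAsymptoticDensity (A : Set ℕ) (d : ℝ) : Prop :=
  Filter.Tendsto (fun N : ℕ => (({n : ℕ | n < N ∧ n ∈ A}.ncard : ℕ) : ℝ) / (N : ℝ))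
    Filter.atTop (nhds d)

/-! Write σ for `fibShift`. Raising all indices by one in a sum of distinct Fibonacci numbers turns
the value n into σ(n), whichever representation of n is used (`fibSum_finsetSucc`). Splitting
partitions by whether they use 1 gives R(n) = ∑ R(x) over σ(x) = n plus ∑ R(x) over σ(x) + 1 = n,
each sum having at most one term. The gap σ(x+1) - σ(x) is 2 if x is a value of σ and 1 otherwise,
so the missed numbers are exactly σ(x) + 1 with x a value of σ.

Hence R(σ(x)) = R(σ(x) + 1) iff x lies in the set B = `fibShiftRuns`, while at a missed number σ(x)
+ 1 equality reduces to R(x) = R(x + 1) with x = σ(y), that is, y ∈ B. The solution set is thus the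
disjoint union of σ(B) and σ(σ(B)) + 1. Since σ multiplies densities by 1/φ and B has density 1 -
2/φ² = 1/φ³, the pieces have densities 1/φ⁴ and 1/φ⁵. -/

open Real Filter Topology

/-! ### The Fibonacci shift -/

/-- The map sending a sum of distinct Fibonacci numbers `fib i`, `2 ≤ i`, to the sum of the
`fib (i + 1)`. -/
noncomputable def fibShift (n : ℕ) : ℕ := ⌊goldenRatio * (n + 1)⌋₊ - 1

theorem one_le_floor_goldenRatio_mul (n : ℕ) : 1 ≤ ⌊goldenRatio * ((n : ℝ) + 1)⌋₊ := by
  rw [Nat.one_le_floor_iff]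
  have := one_lt_goldenRatio
  nlinarith [(Nat.cast_nonneg n : (0 : ℝ) ≤ n)]

theorem fibShift_eq_iff (n m : ℕ) :
    fibShift n = m ↔ (m : ℝ) + 1 ≤ goldenRatio * (n + 1) ∧ goldenRatio * (n + 1) < m + 2 := by
  have h1 := one_le_floor_goldenRatio_mul n
  have h2 : 0 ≤ goldenRatio * ((n : ℝ) + 1) := by
    have := goldenRatio_pos
    positivity
  have h3 : fibShift n = m ↔ ⌊goldenRatio * ((n : ℝ) + 1)⌋₊ = m + 1 := by
    unfold fibShift
    omega
  rw [h3, Nat.floor_eq_iff h2]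
  push_cast
  ring_nf

theorem fibShift_bounds (n : ℕ) :
    (fibShift n : ℝ) + 1 < goldenRatio * (n + 1) ∧ goldenRatio * (n + 1) < fibShift n + 2 := by
  obtain ⟨h1, h2⟩ := (fibShift_eq_iff n _).1 rfl
  refine ⟨lt_of_le_of_ne h1 fun h => ?_, h2⟩
  have : Irrational (goldenRatio * ((n + 1 : ℕ) : ℝ)) :=
    goldenRatio_irrational.mul_natCast (Nat.succ_ne_zero n)
  exact this.ne_nat (fibShift n + 1) (by push_cast; exact h.symm)

theorem goldenRatio_bounds : 1.6 < goldenRatio ∧ goldenRatio < 1.62 := by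
  have h := goldenRatio_sq
  have h0 := goldenRatio_pos
  constructor <;> nlinarith

theorem fibShift_zero : fibShift 0 = 0 := by
  have := goldenRatio_bounds
  rw [fibShift_eq_iff]
  constructor <;> norm_num <;> linarith

theorem fibShift_succ (n : ℕ) :
    fibShift (n + 1) = fibShift n + 1 ∨ fibShift (n + 1) = fibShift n + 2 := by
  obtain ⟨h1, h2⟩ := fibShift_bounds n
  obtain ⟨h3, h4⟩ := fibShift_bounds (n + 1)
  obtain ⟨h5, h6⟩ := goldenRatio_bounds
  push_cast at h3 h4
  have h7 : fibShift n < fibShift (n + 1) := by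
    have : (fibShift n : ℝ) < fibShift (n + 1) := by linarith
    exact_mod_cast this
  have h8 : fibShift (n + 1) < fibShift n + 3 := by
    have : (fibShift (n + 1) : ℝ) < fibShift n + 3 := by linarith
    exact_mod_cast this
  omega

theorem fibShift_strictMono : StrictMono fibShift :=
  strictMono_nat_of_lt_succ fun n => by rcases fibShift_succ n with h | h <;> omega

/-- The Fibonacci recurrence for σ; it follows from φ² = φ + 1. -/
theorem fibShift_fibShift (n : ℕ) : fibShift (fibShift n) = n + fibShift n := by
  obtain ⟨h1, h2⟩ := fibShift_bounds n
  obtain ⟨h5, h6⟩ := goldenRatio_bounds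
  have h := goldenRatio_sq
  rw [fibShift_eq_iff]
  push_cast
  constructor <;> nlinarith

theorem fibShift_fibShift_add_one (n : ℕ) :
    fibShift (fibShift n + 1) = n + fibShift n + 2 := by
  obtain ⟨h1, h2⟩ := fibShift_bounds n
  obtain ⟨h5, h6⟩ := goldenRatio_bounds
  have h := goldenRatio_sq
  rw [fibShift_eq_iff]
  push_cast
  constructor <;> nlinarith

theorem fibShift_succ_of_mem {x : ℕ} (hx : x ∈ Set.range fibShift) :
    fibShift (x + 1) = fibShift x + 2 := by
  obtain ⟨y, rfl⟩ := hx
  rw [fibShift_fibShift_add_one, fibShift_fibShift]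

theorem exists_fibShift_eq_or (n : ℕ) :
    (∃ x, fibShift x = n) ∨ ∃ x, fibShift x + 1 = n ∧ fibShift (x + 1) = n + 1 := by
  induction n with
  | zero => exact .inl ⟨0, fibShift_zero⟩
  | succ n ih =>
    rcases ih with ⟨x, rfl⟩ | ⟨x, -, h⟩
    · rcases fibShift_succ x with h | h
      · exact .inl ⟨x + 1, h⟩
      · exact .inr ⟨x, rfl, h⟩
    · exact .inl ⟨x + 1, h⟩

theorem exists_of_notMem_range_fibShift {n : ℕ} (hn : n ∉ Set.range fibShift) :
    ∃ x, fibShift x + 1 = n ∧ fibShift (x + 1) = n + 1 :=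
  (exists_fibShift_eq_or n).resolve_left hn

theorem fibShift_succ_of_notMem {x : ℕ} (hx : x ∉ Set.range fibShift) :
    fibShift (x + 1) = fibShift x + 1 := by
  obtain ⟨y, h1, h2⟩ := exists_of_notMem_range_fibShift hx
  have h3 := fibShift_fibShift_add_one y
  have h4 := fibShift_fibShift (y + 1)
  rw [h1] at h3
  rw [h2] at h4
  omega

theorem fibShift_add_one_notMem {x : ℕ} (hx : x ∈ Set.range fibShift) :
    fibShift x + 1 ∉ Set.range fibShift := by
  rintro ⟨y, hy⟩
  have h1 := fibShift_succ_of_mem hx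
  have h2 : x < y := fibShift_strictMono.lt_iff_lt.1 (by omega)
  have h3 : y < x + 1 := fibShift_strictMono.lt_iff_lt.1 (by omega)
  omega

/-! ### Sums of distinct Fibonacci numbers -/

/-- The sum of the Fibonacci numbers `1, 2, 3, 5, …` at the positions in `S`. -/
def fibSum (S : Finset ℕ) : ℕ := ∑ i ∈ S, Nat.fib (i + 2)

/-- The embedding of the finite sets of naturals that moves all elements up by one. -/
def finsetSucc (S : Finset ℕ) : Finset ℕ := S.map ⟨Nat.succ, Nat.succ_injective⟩

theorem zero_notMem_finsetSucc (S : Finset ℕ) : 0 ∉ finsetSucc S := by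
  simp [finsetSucc]

theorem finsetSucc_injective : Function.Injective finsetSucc :=
  Finset.map_injective _

theorem exists_finsetSucc_eq {S : Finset ℕ} (hS : 0 ∉ S) :
    ∃ U, S = finsetSucc U := by
  refine ⟨S.image Nat.pred, ?_⟩
  ext i
  simp only [finsetSucc, Finset.mem_map, Finset.mem_image, Function.Embedding.coeFn_mk]
  constructor
  · intro hi
    have : i ≠ 0 := fun h => hS (h ▸ hi)
    exact ⟨i.pred, ⟨i, hi, rfl⟩, Nat.succ_pred this⟩
  · rintro ⟨_, ⟨j, hj, rfl⟩, rfl⟩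
    have : j ≠ 0 := fun h => hS (h ▸ hj)
    rwa [Nat.succ_pred this]

theorem exists_eq_finsetSucc_or (S : Finset ℕ) :
    ∃ U, S = finsetSucc U ∨ S = insert 0 (finsetSucc U) := by
  by_cases h : 0 ∈ S
  · obtain ⟨U, hU⟩ := exists_finsetSucc_eq (Finset.notMem_erase 0 S)
    exact ⟨U, .inr (by rw [← hU, Finset.insert_erase h])⟩
  · obtain ⟨U, hU⟩ := exists_finsetSucc_eq h
    exact ⟨U, .inl hU⟩

theorem sum_goldenConj_pow_finsetSucc (S : Finset ℕ) :
    ∑ i ∈ finsetSucc S, goldenConj ^ (i + 2) = goldenConj * ∑ i ∈ S, goldenConj ^ (i + 2) := by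
  rw [finsetSucc, Finset.sum_map, Finset.mul_sum]
  refine Finset.sum_congr rfl fun i _ => ?_
  simp only [Function.Embedding.coeFn_mk, Nat.succ_eq_add_one]
  ring

/-- With ψ = `goldenConj`, the maps t ↦ ψt and t ↦ ψt + ψ² send the interval (-ψ², -ψ) into itself.
Its length is ψ² - ψ = 1, which is what lets it determine an integer. -/
theorem sum_goldenConj_pow_bounds (S : Finset ℕ) :
    -goldenConj ^ 2 < ∑ i ∈ S, goldenConj ^ (i + 2) ∧
      ∑ i ∈ S, goldenConj ^ (i + 2) < -goldenConj := by
  have h1 := goldenConj_neg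
  have h2 := neg_one_lt_goldenConj
  have h3 := goldenConj_sq
  -- Removing 0 and lowering the other indices decreases the bound N but changes S.
  suffices H : ∀ (N : ℕ) (S : Finset ℕ), S ⊆ Finset.range N →
      -goldenConj ^ 2 < ∑ i ∈ S, goldenConj ^ (i + 2) ∧
      ∑ i ∈ S, goldenConj ^ (i + 2) < -goldenConj by
    obtain ⟨N, hN⟩ := S.exists_nat_subset_range
    exact H N S hN
  intro N
  induction N with
  | zero =>
    intro S hS
    rw [Finset.range_zero, Finset.subset_empty] at hS
    subst hS
    simp only [Finset.sum_empty]
    constructor <;> nlinarith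
  | succ N ih =>
    intro S hS
    obtain ⟨U, hU⟩ := exists_eq_finsetSucc_or S
    have hUN : U ⊆ Finset.range N := by
      intro i hi
      have : i + 1 ∈ S := by
        rcases hU with rfl | rfl
        · exact Finset.mem_map_of_mem _ hi
        · exact Finset.mem_insert_of_mem (Finset.mem_map_of_mem _ hi)
      have := hS this
      rw [Finset.mem_range] at this ⊢
      omega
    obtain ⟨h4, h5⟩ := ih U hUN
    rcases hU with rfl | rfl
    · rw [sum_goldenConj_pow_finsetSucc]
      constructor <;> nlinarith
    · rw [Finset.sum_insert (zero_notMem_finsetSucc U), sum_goldenConj_pow_finsetSucc]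
      simp only [zero_add]
      constructor <;> nlinarith

/-- Since F_{k+1} - φF_k = ψ^k, the shifted sum differs from φ times the sum by an error in a window
of length one, which singles out one integer. -/
theorem fibSum_finsetSucc (S : Finset ℕ) : fibSum (finsetSucc S) = fibShift (fibSum S) := by
  symm
  have hconj (i : ℕ) : (Nat.fib (i + 1) : ℝ) - goldenRatio * Nat.fib i = goldenConj ^ i :=
    Real.fib_succ_sub_goldenRatio_mul_fib i
  have key : (fibSum (finsetSucc S) : ℝ) - goldenRatio * fibSum S =
      ∑ i ∈ S, goldenConj ^ (i + 2) := by
    unfold fibSum finsetSucc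
    rw [Finset.sum_map]
    push_cast
    rw [Finset.mul_sum, ← Finset.sum_sub_distrib]
    exact Finset.sum_congr rfl fun i _ => hconj (i + 2)
  obtain ⟨h1, h2⟩ := sum_goldenConj_pow_bounds S
  have h3 := goldenConj_sq
  have h4 := goldenRatio_add_goldenConj
  rw [fibShift_eq_iff]
  constructor <;> linarith

theorem fibSum_insert_zero (S : Finset ℕ) :
    fibSum (insert 0 (finsetSucc S)) = fibShift (fibSum S) + 1 := by
  rw [← fibSum_finsetSucc, fibSum, Finset.sum_insert (zero_notMem_finsetSucc S), add_comm]
  rfl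

theorem fib_add_two_injective : Function.Injective fun i : ℕ => Nat.fib (i + 2) :=
  Nat.fib_add_two_strictMono.injective

theorem setOf_isFibPartition_eq_image (n : ℕ) :
    {S : Finset ℕ | IsFibPartition n S} =
      Finset.map ⟨fun i : ℕ => Nat.fib (i + 2), fib_add_two_injective⟩ '' {S | fibSum S = n} := by
  ext P
  simp only [Set.mem_ofPred_eq, Set.mem_image, IsFibPartition]
  constructor
  · rintro ⟨h1, h2⟩
    have hP : (P : Set ℕ) ⊆ Set.range fun i : ℕ => Nat.fib (i + 2) := by
      intro x hx
      obtain ⟨k, hk, rfl⟩ := h1 x hx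
      exact ⟨k - 2, by simp only [Nat.sub_add_cancel hk]⟩
    refine ⟨P.preimage _ fib_add_two_injective.injOn, ?_, ?_⟩
    · rw [fibSum, Finset.sum_preimage (fun i : ℕ => Nat.fib (i + 2)) P
        fib_add_two_injective.injOn (fun x => x) fun x hx h => absurd (hP hx) h, h2]
    · rw [Finset.map_eq_image]
      refine Finset.coe_injective ?_
      rw [Finset.coe_image, Finset.coe_preimage]
      exact Set.image_preimage_eq_of_subset hP
  · rintro ⟨S, rfl, rfl⟩
    refine ⟨fun x hx => ?_, by rw [Finset.sum_map]; rfl⟩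
    obtain ⟨i, -, rfl⟩ := Finset.mem_map.1 hx
    exact ⟨i + 2, by omega, rfl⟩

theorem fibPartitionCount_eq_ncard (n : ℕ) :
    fibPartitionCount n = {S | fibSum S = n}.ncard := by
  rw [fibPartitionCount, setOf_isFibPartition_eq_image,
    Set.ncard_image_of_injective _ (Finset.map_injective _)]

theorem finite_setOf_fibSum_eq (n : ℕ) : {S | fibSum S = n}.Finite := by
  have h := finite_setOf_isFibPartition n
  rw [setOf_isFibPartition_eq_image] at h
  exact h.of_finite_image (Finset.map_injective _).injOn

/-! ### The recursion for the partition function -/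

theorem setOf_fibSum_eq (n : ℕ) :
    {S | fibSum S = n} = finsetSucc '' {S | fibShift (fibSum S) = n} ∪
      (fun S => insert 0 (finsetSucc S)) '' {S | fibShift (fibSum S) + 1 = n} := by
  ext S
  constructor
  · intro hS
    obtain ⟨U, rfl | rfl⟩ := exists_eq_finsetSucc_or S
    · exact .inl ⟨U, (fibSum_finsetSucc U).symm.trans hS, rfl⟩
    · exact .inr ⟨U, (fibSum_insert_zero U).symm.trans hS, rfl⟩
  · rintro (⟨U, hU, rfl⟩ | ⟨U, hU, rfl⟩)
    · exact (fibSum_finsetSucc U).trans hU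
    · exact (fibSum_insert_zero U).trans hU

theorem insert_zero_finsetSucc_injective :
    Function.Injective fun S => insert 0 (finsetSucc S) := by
  intro S U h
  have := congrArg (fun V => V.erase 0) h
  simp only [Finset.erase_insert (zero_notMem_finsetSucc _)] at this
  exact finsetSucc_injective this

theorem fibPartitionCount_eq_add (n : ℕ) :
    fibPartitionCount n = {S | fibShift (fibSum S) = n}.ncard +
      {S | fibShift (fibSum S) + 1 = n}.ncard := by
  have hfin := finite_setOf_fibSum_eq n
  rw [setOf_fibSum_eq, Set.finite_union] at hfin
  rw [fibPartitionCount_eq_ncard, setOf_fibSum_eq,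
    Set.ncard_union_eq ?_ hfin.1 hfin.2,
    Set.ncard_image_of_injective _ finsetSucc_injective,
    Set.ncard_image_of_injective _ insert_zero_finsetSucc_injective]
  rw [Set.disjoint_left]
  rintro _ ⟨U, -, rfl⟩ ⟨V, -, hV⟩
  exact zero_notMem_finsetSucc U (hV ▸ Finset.mem_insert_self _ _)

theorem ncard_fibShift_fibSum_eq (x : ℕ) :
    {S | fibShift (fibSum S) = fibShift x}.ncard = fibPartitionCount x := by
  rw [fibPartitionCount_eq_ncard]
  simp only [fibShift_strictMono.injective.eq_iff]

theorem ncard_fibShift_fibSum_eq_zero {n : ℕ} (hn : n ∉ Set.range fibShift) :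
    {S | fibShift (fibSum S) = n}.ncard = 0 := by
  convert Set.ncard_empty (Finset ℕ)
  exact Set.eq_empty_of_forall_notMem fun S hS => hn ⟨_, hS⟩

theorem fibPartitionCount_fibShift_add_one {x : ℕ} (hx : x ∈ Set.range fibShift) :
    fibPartitionCount (fibShift x + 1) = fibPartitionCount x := by
  rw [fibPartitionCount_eq_add, ncard_fibShift_fibSum_eq_zero (fibShift_add_one_notMem hx)]
  simp only [add_left_inj, zero_add]
  exact ncard_fibShift_fibSum_eq x

theorem fibPartitionCount_fibShift_succ_of_mem {x : ℕ} (hx : x ∈ Set.range fibShift) :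
    fibPartitionCount (fibShift (x + 1)) = fibPartitionCount (x + 1) := by
  rw [fibPartitionCount_eq_add, ncard_fibShift_fibSum_eq, fibShift_succ_of_mem hx]
  simp only [Nat.add_right_cancel_iff, add_eq_left,
    show fibShift x + 2 = fibShift x + 1 + 1 from rfl]
  exact ncard_fibShift_fibSum_eq_zero (fibShift_add_one_notMem hx)

theorem fibPartitionCount_fibShift_succ_of_notMem {x : ℕ} (hx : x ∉ Set.range fibShift) :
    fibPartitionCount (fibShift (x + 1)) = fibPartitionCount (x + 1) + fibPartitionCount x := by
  rw [fibPartitionCount_eq_add, ncard_fibShift_fibSum_eq, fibShift_succ_of_notMem hx]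
  simp only [Nat.add_right_cancel_iff, ncard_fibShift_fibSum_eq]

theorem exists_fibSum_eq (n : ℕ) : ∃ S, fibSum S = n := by
  induction n using Nat.strong_induction_on with
  | _ n ih =>
    rcases exists_fibShift_eq_or n with ⟨x, rfl⟩ | ⟨x, rfl, -⟩
    · rcases Nat.eq_zero_or_pos x with rfl | hx
      · exact ⟨∅, by rw [fibShift_zero]; rfl⟩
      -- Here σ(1) = 2 and strict monotonicity gives σ(y + 1) ≥ y + 2.
      · have h1 : x < fibShift x := by
          obtain ⟨y, rfl⟩ := Nat.exists_eq_add_of_lt hx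
          have h0 := fibShift_succ_of_mem ⟨0, fibShift_zero⟩
          have h2 := fibShift_strictMono.add_le_nat y 1
          rw [fibShift_zero] at h0
          simp only [zero_add] at *
          omega
        obtain ⟨S, hS⟩ := ih x h1
        exact ⟨finsetSucc S, by rw [fibSum_finsetSucc, hS]⟩
    · obtain ⟨S, hS⟩ := ih x (Nat.lt_succ_of_le fibShift_strictMono.le_apply)
      exact ⟨insert 0 (finsetSucc S), by rw [fibSum_insert_zero, hS]⟩

theorem fibPartitionCount_pos (n : ℕ) : 0 < fibPartitionCount n := by
  rw [fibPartitionCount_eq_ncard, Set.ncard_pos (finite_setOf_fibSum_eq n)]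
  exact exists_fibSum_eq n

/-! ### The solutions of `R(n) = R(n + 1)` -/

/-- The numbers `x` in the range of `fibShift` such that `x = 0` or `x - 1` is in this range. -/
def fibShiftRuns : Set ℕ := ((Set.range fibShift)ᶜ ∪ Nat.succ '' (Set.range fibShift)ᶜ)ᶜ

theorem zero_mem_fibShiftRuns : 0 ∈ fibShiftRuns := by
  simp only [fibShiftRuns, Set.mem_compl_iff, Set.mem_union, not_or, not_not]
  exact ⟨⟨0, fibShift_zero⟩, by rintro ⟨y, -, hy⟩; exact Nat.succ_ne_zero y hy⟩

theorem succ_mem_fibShiftRuns {x : ℕ} :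
    x + 1 ∈ fibShiftRuns ↔ x + 1 ∈ Set.range fibShift ∧ x ∈ Set.range fibShift := by
  simp only [fibShiftRuns, Set.mem_compl_iff, Set.mem_union, not_or, not_not]
  refine and_congr_right fun _ => ⟨fun h => ?_, ?_⟩
  · by_contra hx
    exact h ⟨x, hx, rfl⟩
  · rintro hx ⟨y, hy, h⟩
    exact hy (Nat.succ_injective h ▸ hx)

theorem fibShiftRuns_subset_range : fibShiftRuns ⊆ Set.range fibShift := fun x hx => by
  by_contra h
  exact hx (.inl h)

theorem fibPartitionCount_fibShift_eq_succ_iff (x : ℕ) :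
    fibPartitionCount (fibShift x) = fibPartitionCount (fibShift x + 1) ↔ x ∈ fibShiftRuns := by
  by_cases hx : x ∈ Set.range fibShift
  · rw [fibPartitionCount_fibShift_add_one hx]
    rcases x with _ | x
    · simp only [fibShift_zero, zero_mem_fibShiftRuns]
    · rw [succ_mem_fibShiftRuns]
      by_cases h : x ∈ Set.range fibShift
      · simp only [fibPartitionCount_fibShift_succ_of_mem h, hx, h, and_self]
      · have := fibPartitionCount_pos x
        simp only [fibPartitionCount_fibShift_succ_of_notMem h, h, and_false, iff_false]
        omega
  · refine iff_of_false ?_ fun h => hx (fibShiftRuns_subset_range h)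
    -- For x missed, R(σ(x)) = R(x), and R(σ(x) + 1) exceeds it by R(x + 1) > 0.
    rw [← fibShift_succ_of_notMem hx, fibPartitionCount_fibShift_succ_of_notMem hx]
    obtain ⟨y, rfl, -⟩ := exists_of_notMem_range_fibShift hx
    rw [fibPartitionCount_fibShift_succ_of_mem ⟨y, rfl⟩]
    have := fibPartitionCount_pos (fibShift y + 1 + 1)
    omega

theorem setOf_fibPartitionCount_eq_succ :
    {n : ℕ | fibPartitionCount n = fibPartitionCount (n + 1)} =
      fibShift '' fibShiftRuns ∪ Nat.succ '' (fibShift '' (fibShift '' fibShiftRuns)) := by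
  ext n
  rw [Set.mem_ofPred_eq, Set.mem_union]
  by_cases hn : n ∈ Set.range fibShift
  · obtain ⟨x, rfl⟩ := hn
    rw [fibPartitionCount_fibShift_eq_succ_iff, fibShift_strictMono.injective.mem_set_image]
    refine (or_iff_left ?_).symm
    rintro ⟨_, ⟨_, ⟨z, -, rfl⟩, rfl⟩, h⟩
    exact fibShift_add_one_notMem ⟨z, rfl⟩ ⟨x, h.symm⟩
  · obtain ⟨x, rfl, h⟩ := exists_of_notMem_range_fibShift hn
    have hx : x ∈ Set.range fibShift := by
      by_contra hx
      have := fibShift_succ_of_notMem hx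
      omega
    rw [fibPartitionCount_fibShift_add_one hx, ← h, fibPartitionCount_fibShift_succ_of_mem hx,
      or_iff_right fun h => hn (Set.image_subset_range _ _ h), ← Nat.succ_eq_add_one,
      Nat.succ_injective.mem_set_image, fibShift_strictMono.injective.mem_set_image]
    obtain ⟨y, rfl⟩ := hx
    rw [fibPartitionCount_fibShift_eq_succ_iff, fibShift_strictMono.injective.mem_set_image]

/-! ### Asymptotic densities -/

theorem HasAsymptoticDensity.union {A B : Set ℕ} {a b : ℝ} (hA : HasAsymptoticDensity A a)
    (hB : HasAsymptoticDensity B b) (h : Disjoint A B) : HasAsymptoticDensity (A ∪ B) (a + b) := by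
  refine (hA.add hB).congr fun N => ?_
  have hfin (C : Set ℕ) : {n | n < N ∧ n ∈ C}.Finite :=
    (Set.finite_lt_nat N).subset fun _ hn => hn.1
  rw [← add_div, ← Nat.cast_add, ← Set.ncard_union_eq ?_ (hfin A) (hfin B)]
  · congr 3
    ext n
    simp only [Set.mem_union, Set.mem_ofPred_eq, and_or_left]
  · exact Set.disjoint_left.2 fun n hA hB => Set.disjoint_left.1 h hA.2 hB.2

theorem hasAsymptoticDensity_univ : HasAsymptoticDensity Set.univ 1 := by
  refine tendsto_const_nhds.congr' ?_
  filter_upwards [eventually_gt_atTop 0] with N hN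
  have : {n : ℕ | n < N ∧ n ∈ Set.univ}.ncard = N := by
    have h : {n : ℕ | n < N ∧ n ∈ Set.univ} = (Finset.range N : Set ℕ) := by
      ext n
      simp
    rw [h, Set.ncard_coe_finset, Finset.card_range]
  rw [this, div_self (by positivity)]

theorem HasAsymptoticDensity.compl {A : Set ℕ} {a : ℝ} (hA : HasAsymptoticDensity A a) :
    HasAsymptoticDensity Aᶜ (1 - a) := by
  refine (hasAsymptoticDensity_univ.sub hA).congr fun N => ?_
  have hfin (C : Set ℕ) : {n | n < N ∧ n ∈ C}.Finite :=
    (Set.finite_lt_nat N).subset fun _ hn => hn.1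
  have : {n | n < N ∧ n ∈ Set.univ}.ncard =
      {n | n < N ∧ n ∈ A}.ncard + {n | n < N ∧ n ∈ Aᶜ}.ncard := by
    rw [← Set.ncard_union_eq ?_ (hfin A) (hfin _)]
    · congr 1
      ext n
      simp only [Set.mem_union, Set.mem_ofPred_eq, Set.mem_univ, Set.mem_compl_iff, ← and_or_left,
        em]
    · exact Set.disjoint_left.2 fun n hA hB => hB.2 hA.2
  rw [this, ← sub_div]
  push_cast
  ring

/-- The image has as many elements below N as A has below c N, so the ratio factors through c N / N
→ κ. -/
theorem HasAsymptoticDensity.image {A : Set ℕ} {a κ : ℝ} (hA : HasAsymptoticDensity A a)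
    {f c : ℕ → ℕ} (hf : Function.Injective f) (hfc : ∀ x N, f x < N ↔ x < c N)
    (hc : Tendsto (fun N : ℕ => (c N : ℝ) / N) atTop (𝓝 κ)) :
    HasAsymptoticDensity (f '' A) (a * κ) := by
  have hc' : Tendsto c atTop atTop := by
    refine tendsto_atTop.2 fun b => ?_
    filter_upwards [eventually_gt_atTop (f b)] with N hN
    exact ((hfc b N).1 hN).le
  refine ((hA.comp hc').mul hc).congr' ?_
  filter_upwards [hc'.eventually_gt_atTop 0] with N hN
  have : {n | n < N ∧ n ∈ f '' A} = f '' {x | x < c N ∧ x ∈ A} := by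
    ext n
    simp only [Set.mem_ofPred_eq, Set.mem_image]
    constructor
    · rintro ⟨h, x, hx, rfl⟩
      exact ⟨x, ⟨(hfc x N).1 h, hx⟩, rfl⟩
    · rintro ⟨x, ⟨h, hx⟩, rfl⟩
      exact ⟨(hfc x N).2 h, x, hx, rfl⟩
  rw [this, Set.ncard_image_of_injective _ hf, Function.comp_apply,
    div_mul_div_cancel₀ (by positivity)]

theorem HasAsymptoticDensity.image_succ {A : Set ℕ} {a : ℝ} (hA : HasAsymptoticDensity A a) :
    HasAsymptoticDensity (Nat.succ '' A) a := by
  have h : Tendsto (fun N : ℕ => ((N - 1 : ℕ) : ℝ) / N) atTop (𝓝 1) := by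
    have := (tendsto_const_nhds (x := (1 : ℝ))).sub tendsto_one_div_atTop_nhds_zero_nat
    rw [sub_zero] at this
    refine this.congr' ?_
    filter_upwards [eventually_gt_atTop 0] with N hN
    rw [Nat.cast_pred hN, sub_div, div_self (by positivity)]
  simpa only [mul_one] using
    hA.image (c := fun N => N - 1) Nat.succ_injective (fun x N => by omega) h

theorem fibShift_lt_iff (x N : ℕ) :
    fibShift x < N ↔ x < ⌈goldenRatio⁻¹ * ((N + 1 : ℕ) : ℝ)⌉₊ - 1 := by
  have h1 := one_le_floor_goldenRatio_mul x
  have h2 : fibShift x < N ↔ ⌊goldenRatio * ((x : ℝ) + 1)⌋₊ < N + 1 := by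
    unfold fibShift
    omega
  rw [h2, lt_tsub_iff_right, Nat.lt_ceil, Nat.floor_lt (by have := goldenRatio_pos; positivity),
    lt_inv_mul_iff₀ goldenRatio_pos]
  push_cast
  rfl

theorem HasAsymptoticDensity.image_fibShift {A : Set ℕ} {a : ℝ} (hA : HasAsymptoticDensity A a) :
    HasAsymptoticDensity (fibShift '' A) (a * goldenRatio⁻¹) := by
  refine hA.image fibShift_strictMono.injective fibShift_lt_iff ?_
  have hpos : 0 < goldenRatio⁻¹ := inv_pos.2 goldenRatio_pos
  have h0 := tendsto_one_div_atTop_nhds_zero_nat (𝕜 := ℝ)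
  have hlow : Tendsto (fun N : ℕ => goldenRatio⁻¹ - 1 * (1 / (N : ℝ))) atTop (𝓝 goldenRatio⁻¹) := by
    simpa using tendsto_const_nhds.sub (h0.const_mul 1)
  have hupp : Tendsto (fun N : ℕ => goldenRatio⁻¹ + goldenRatio⁻¹ * (1 / (N : ℝ))) atTop
      (𝓝 goldenRatio⁻¹) := by
    simpa using tendsto_const_nhds.add (h0.const_mul goldenRatio⁻¹)
  have hcast (N : ℕ) : ((⌈goldenRatio⁻¹ * ((N + 1 : ℕ) : ℝ)⌉₊ - 1 : ℕ) : ℝ) =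
      ⌈goldenRatio⁻¹ * ((N + 1 : ℕ) : ℝ)⌉₊ - 1 :=
    Nat.cast_pred (Nat.ceil_pos.2 (by positivity))
  refine tendsto_of_tendsto_of_tendsto_of_le_of_le' hlow hupp ?_ ?_ <;>
    filter_upwards [eventually_gt_atTop 0] with N hN <;>
    have hN' : (0 : ℝ) < N := Nat.cast_pos.2 hN
  · rw [le_div_iff₀ hN', hcast]
    have := Nat.le_ceil (goldenRatio⁻¹ * ((N + 1 : ℕ) : ℝ))
    push_cast at this ⊢
    field_simp at this ⊢
    nlinarith
  · rw [div_le_iff₀ hN', hcast]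
    have := Nat.ceil_lt_add_one (a := goldenRatio⁻¹ * ((N + 1 : ℕ) : ℝ)) (by positivity)
    have h1 : (goldenRatio⁻¹ + goldenRatio⁻¹ * (1 / (N : ℝ))) * N =
        goldenRatio⁻¹ * ((N + 1 : ℕ) : ℝ) := by
      push_cast
      field_simp
    linarith

/-- No two consecutive numbers are missed by σ, so the missed set and its translate by one are
disjoint and their densities add. -/
theorem hasAsymptoticDensity_fibShiftRuns :
    HasAsymptoticDensity fibShiftRuns (1 - ((1 - goldenRatio⁻¹) + (1 - goldenRatio⁻¹))) := by
  have h : HasAsymptoticDensity (Set.range fibShift)ᶜ (1 - goldenRatio⁻¹) := by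
    have := hasAsymptoticDensity_univ.image_fibShift.compl
    rwa [Set.image_univ, one_mul] at this
  refine (h.union h.image_succ ?_).compl
  rw [Set.disjoint_left]
  rintro _ h1 ⟨x, h2, rfl⟩
  obtain ⟨y, rfl, h3⟩ := exists_of_notMem_range_fibShift h2
  exact h1 ⟨y + 1, h3⟩

theorem goldenRatio_inv_sq : goldenRatio⁻¹ ^ 2 = 1 - goldenRatio⁻¹ := by
  have h := goldenRatio_sq
  have h0 := inv_mul_cancel₀ goldenRatio_ne_zero
  linear_combination -goldenRatio⁻¹ ^ 2 * h +
    (goldenRatio⁻¹ * goldenRatio + 1 - goldenRatio⁻¹) * h0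

theorem corollary1 :
    HasAsymptoticDensity {n : ℕ | fibPartitionCount n = fibPartitionCount (n + 1)}
        (1 / Real.goldenRatio ^ 4 + 1 / Real.goldenRatio ^ 5) ∧
      1 / Real.goldenRatio ^ 4 + 1 / Real.goldenRatio ^ 5 = 1 / Real.goldenRatio ^ 3 ∧
      |1 / Real.goldenRatio ^ 3 - 0.236| < 0.0005 := by
  have hsq := goldenRatio_inv_sq
  have hcube : goldenRatio⁻¹ ^ 3 = 2 * goldenRatio⁻¹ - 1 := by
    linear_combination (goldenRatio⁻¹ - 1) * hsq
  simp only [one_div, ← inv_pow]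
  refine ⟨?_, by linear_combination goldenRatio⁻¹ ^ 3 * hsq, ?_⟩
  · rw [setOf_fibPartitionCount_eq_succ]
    have hruns := hasAsymptoticDensity_fibShiftRuns.image_fibShift
    convert hruns.union hruns.image_fibShift.image_succ ?_ using 1
    · linear_combination (goldenRatio⁻¹ + goldenRatio⁻¹ ^ 2) * hcube
    · rw [Set.disjoint_left]
      rintro _ ⟨x, -, rfl⟩ ⟨_, ⟨_, ⟨z, -, rfl⟩, rfl⟩, h⟩
      exact fibShift_add_one_notMem ⟨z, rfl⟩ ⟨x, h.symm⟩
  · have hpos : 0 < goldenRatio⁻¹ := inv_pos.2 goldenRatio_pos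
    rw [hcube, abs_lt]
    constructor <;> nlinarith
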